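/- Setting. Let $M$ be a (Hausdorff, boundaryless) $C^\infty$ manifold of dimension $2n$; all objects are $C^\infty$ and all brackets of vector forms are Frölicher–Nijenhuis brackets. Let $L$ be a vector $1$-form on $M$ of constant rank $n$ with $[L,L]=0$ and $\operatorname{Im}L_z=\operatorname{Ker}L_z=:V_z(M)$ (the vertical space) for every $z\in M$, and let $C$ be the canonical vector field on $M$, a vertical vector field with $[C,L]=-L$. A vector form $K$ is homogeneous of degree $r$ if $[C,K]=(r-1)K$. An $L$-spray is a vector field $S$, homogeneous of degree $2$, with $LS=C$. An $L$-connection is a vector $1$-form $\Gamma$ with $L\Gamma=L$ and $\Gamma L=-L$; it is conservative if it is homogeneous of degree $1$ and $\Gamma=[L,S]$ for some $L$-spray $S$. Put $h=\frac12(I+\Gamma)$, $v=\frac12(I-\Gamma)$, $\Omega=-\frac12[h,h]$ (the curvature of $\Gamma$), and let $F$ be the almost-complex structure associated with $\Gamma$, i.e. the vector $1$-form with $FL=h$ and $Fh=-L$. A linear connection $D$ on $M$ is $L$-normal if $DL=0$ and $D_{LX}C=LX$ for all $X$. It is $L$-regular if $DL=0$ and the connection map $K:X\mapsto D_XC$ restricts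 to an isomorphism of the vertical bundle, with inverse $\varphi$; the $L$-connection induced by an $L$-regular $D$ is $HG$, where, with $v_D=\varphi\circ K$ and $h_D=I-v_D$, the vector $1$-forms $G,H$ are given by $GL=-h_D$, $Gh_D=L$, $HL=h_D$, $Hh_D=L$. The Berwald $L$-lift of $\Gamma$ is the $L$-normal linear connection $D$ which induces $\Gamma$, is reducible ($D\Gamma=0$), and whose torsion satisfies $\mathbf T(LX,Y)=0$ for all $X,Y$. With $\mathbf R(X,Y)Z=D_XD_YZ-D_YD_XZ-D_{[X,Y]}Z$ put $$R(X,Y)Z=\mathbf R(hX,hY)LZ,\qquad P(X,Y)Z=\mathbf R(hX,LY)LZ,$$ and let $\mathfrak S$ denote the cyclic sum over $X,Y,Z$. Proposition. Let $D$ be the Berwald $L$-lift of a conservative $L$-connection $\Gamma$ on $M$. Then for all vector fields $X,Y,Z$ on $M$: (a) $\mathfrak S\,R(X,Y)Z=0$; (b) $\mathfrak S\,(D_{hX}R)(Y,Z)=\mathfrak S\,P(X,F\Omega(Y,Z))$; (c) $(D_{LZ}R)(X,Y)=(D_{hY}P)(X,Z)-(D_{hX}P)(Y,Z)$; (d) $(D_{LZ}P)(X,Y)=(D_{LY}P)(X,Z)$;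 (e) $P(X,Y)Z=P(Y,X)Z=P(Z,X)Y$, so $P$ is symmetric in its three variables. Here (b), (c) and (d) are equalities of vector $1$-forms, i.e. they hold after evaluation on an arbitrary vector field $W$. -/

import Mathlib

open scoped Manifold ContDiff

namespace LConn

noncomputable section

section Basic

variable {E : Type*} [NormedAddCommGroup E] [NormedSpace ℝ E]
  {H : Type*} [TopologicalSpace H] (I : ModelWithCorners ℝ E H)
  (M : Type*) [TopologicalSpace M] [ChartedSpace H M] [IsManifold I ∞ M]

/-- Smooth vector fields on `M`. -/
abbrev VField : Type _ := Cₛ^∞⟮I; E, (TangentSpace I : M → Type _)⟯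

/-- Smooth vector `1`-forms on `M`, that is, smooth sections of `End(TM)`. -/
abbrev VForm : Type _ :=
  Cₛ^∞⟮I; E →L[ℝ] E, (fun x : M => TangentSpace I x →L[ℝ] TangentSpace I x)⟯

variable {I M}

/-- A vector `1`-form as an operator on smooth vector fields: `(K X)(z) = K_z (X_z)`. -/
def op (K : VForm I M) : Module.End ℝ (VField I M) where
  toFun X := ⟨fun z => K z (X z), ContMDiff.clm_bundle_apply K.contMDiff X.contMDiff⟩
  map_add' X Y := by ext z; simp
  map_smul' c X := by ext z; simp

/-- The vertical space at `z`: the image of `L_z`. -/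
def vert (L : VForm I M) (z : M) : Submodule ℝ (TangentSpace I z) := (L z).range

end Basic

section Bracket

variable {E : Type*} [NormedAddCommGroup E] [NormedSpace ℝ E] [FiniteDimensional ℝ E]
  {H : Type*} [TopologicalSpace H] {I : ModelWithCorners ℝ E H}
  {M : Type*} [TopologicalSpace M] [ChartedSpace H M] [IsManifold I ∞ M]

/-- The Lie bracket `[X, Y]` of smooth vector fields. -/
def lie (X Y : VField I M) : VField I M :=
  ⟨VectorField.mlieBracket I X Y, by
    have : CompleteSpace E := FiniteDimensional.complete ℝ E
    have : IsManifold I (((⊤ : ℕ∞) : WithTop ℕ∞) + 1) M := by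
      have h : (((⊤ : ℕ∞) : WithTop ℕ∞) + 1) = ∞ := rfl
      rw [h]; infer_instance
    have : IsManifold I (minSmoothness ℝ 2) M := by
      rw [minSmoothness_of_isRCLikeNormedField]; infer_instance
    exact ContDiff.mlieBracket_vectorField (m := ⊤) (n := ⊤) X.contMDiff Y.contMDiff
      (by rw [minSmoothness_of_isRCLikeNormedField]; exact le_rfl)⟩

/-- The Frölicher–Nijenhuis bracket `[X, K]` of a vector field and a vector `1`-form,
evaluated at `Y`. -/
def fnFieldForm (X : VField I M) (K : Module.End ℝ (VField I M)) (Y : VField I M) : VField I M :=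
  lie X (K Y) - K (lie X Y)

/-- The Frölicher–Nijenhuis bracket `[K, X]` of a vector `1`-form and a vector field,
evaluated at `Y`; it equals `-[X, K]`. -/
def fnFormField (K : Module.End ℝ (VField I M)) (X : VField I M) (Y : VField I M) : VField I M :=
  -fnFieldForm X K Y

/-- The Frölicher–Nijenhuis bracket `[K, N]` of two vector `1`-forms, evaluated at `X, Y`. -/
def fnFormForm (K N : Module.End ℝ (VField I M)) (X Y : VField I M) : VField I M :=
  lie (K X) (N Y) + lie (N X) (K Y) + K (N (lie X Y)) + N (K (lie X Y))
    - K (lie (N X) Y) - K (lie X (N Y)) - N (lie (K X) Y) - N (lie X (K Y))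

/-- The geometric setting: on the `2n`-dimensional manifold `M`, `L` is a vector `1`-form of
constant rank `n` with `[L, L] = 0` and `Im L_z = Ker L_z`, and `C` is a canonical vector field of
`L`: a vertical vector field with `[C, L] = -L`. -/
structure IsLStructure (n : ℕ) (L : VForm I M) (C : VField I M) : Prop where
  dim_eq : Module.finrank ℝ E = 2 * n
  rank_eq : ∀ z : M, Module.finrank ℝ (vert L z) = n
  range_eq_ker : ∀ z : M, (L z).range = (L z).ker
  nijenhuis : ∀ X Y : VField I M, fnFormForm (op L) (op L) X Y = 0
  canonical_vertical : ∀ z : M, C z ∈ vert L z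
  canonical_bracket : ∀ X : VField I M, fnFieldForm C (op L) X = -op L X

/-- A vector field `X` is homogeneous of degree `r`: `[C, X] = (r - 1) X`. -/
def FieldHomogeneous (C : VField I M) (r : ℤ) (X : VField I M) : Prop :=
  lie C X = (r - 1) • X

/-- A vector `1`-form `K` is homogeneous of degree `r`: `[C, K] = (r - 1) K`. -/
def FormHomogeneous (C : VField I M) (r : ℤ) (K : VForm I M) : Prop :=
  ∀ X : VField I M, fnFieldForm C (op K) X = (r - 1) • op K X

/-- An `L`-semispray: `L S = C`. -/
def IsSemispray (L : VForm I M) (C S : VField I M) : Prop := op L S = C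

/-- An `L`-spray: an `L`-semispray homogeneous of degree `2`. -/
def IsSpray (L : VForm I M) (C S : VField I M) : Prop :=
  IsSemispray L C S ∧ FieldHomogeneous C 2 S

/-- A (nonlinear) `L`-connection: `L Γ = L` and `Γ L = -L`. -/
structure IsLConnection (L Γ : VForm I M) : Prop where
  left : ∀ (z : M) (w : TangentSpace I z), L z (Γ z w) = L z w
  right : ∀ (z : M) (w : TangentSpace I z), Γ z (L z w) = -L z w

/-- A conservative `L`-connection: a homogeneous (of degree `1`) `L`-connection of the form
`Γ = [L, S]` for some `L`-spray `S`. -/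
structure IsConservative (L : VForm I M) (C : VField I M) (Γ : VForm I M) : Prop where
  connection : IsLConnection L Γ
  homogeneous : FormHomogeneous C 1 Γ
  exists_spray : ∃ S : VField I M, IsSpray L C S ∧
    ∀ X : VField I M, op Γ X = fnFormField (op L) S X

/-- The horizontal projector `h = (I + Γ) / 2`. -/
def hor (Γ : VForm I M) : Module.End ℝ (VField I M) := (1 / 2 : ℝ) • (1 + op Γ)

/-- The curvature `Ω = -[h, h] / 2` of an `L`-connection. -/
def Omega (Γ : VForm I M) (X Y : VField I M) : VField I M :=
  -((1 / 2 : ℝ) • fnFormForm (hor Γ) (hor Γ) X Y)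

/-- `F` is the almost-complex structure associated with `Γ`: the vector `1`-form determined by
`F L = h` and `F h = -L`. -/
structure IsAssociatedComplex (L Γ F : VForm I M) : Prop where
  comp_L : ∀ X : VField I M, op F (op L X) = hor Γ X
  comp_h : ∀ X : VField I M, op F (hor Γ X) = -op L X

/-! Linear connections -/

/-- `D_X Y`, for a smooth linear connection `D` and smooth vector fields `X`, `Y`. -/
def nabla (D : CovariantDerivative I E (TangentSpace I : M → Type _))
    [hD : CovariantDerivative.ContMDiffCovariantDerivative D ∞] (X Y : VField I M) : VField I M :=
  ⟨fun z => D Y z (X z), by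
    refine ContMDiff.clm_bundle_apply (ϕ := fun z => D Y z) ?_ X.contMDiff
    have h := hD.contMDiff.contMDiff (σ := ⇑Y)
      (by
        have e : (∞ + 1 : WithTop ℕ∞) = ∞ := rfl
        rw [contMDiffOn_univ, e]; exact Y.contMDiff)
    simpa only [contMDiffOn_univ] using h⟩

variable (D : CovariantDerivative I E (TangentSpace I : M → Type _))
  [CovariantDerivative.ContMDiffCovariantDerivative D ∞]

/-- `D K = 0` for a vector `1`-form `K`. -/
def IsParallel (K : VForm I M) : Prop :=
  ∀ X Y : VField I M, nabla D X (op K Y) = op K (nabla D X Y)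

/-- The connection map `K = D C`, `K_z(w) = D_w C`. -/
def connMap (C : VField I M) (z : M) : TangentSpace I z →L[ℝ] TangentSpace I z := D C z

/-- `L`-normal linear connections: `D L = 0` and `D_{LX} C = LX`. -/
structure IsLNormal (L : VForm I M) (C : VField I M) : Prop where
  almostTangent : IsParallel D L
  normal : ∀ X : VField I M, nabla D (op L X) C = op L X

/-- `D` is `L`-regular: `D L = 0` and the connection map restricts to an isomorphism of each
vertical space. -/
structure IsLRegular (L : VForm I M) (C : VField I M) : Prop where
  almostTangent : IsParallel D L
  bijOn : ∀ z : M, Set.BijOn (connMap D C z) (vert L z) (vert L z)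

/-- `Γ` is the `L`-connection induced by the `L`-regular linear connection `D`: with `K` the
connection map, `φ` the inverse of `K` on the vertical bundle, `v = φ ∘ K` and `h = I - v`, and with
`G`, `N` the vector `1`-forms given by `G L = -h`, `G h = L`, `N L = h`, `N h = L`, one has
`Γ = N G`. -/
def IsInducedBy (L : VForm I M) (C : VField I M) (Γ : VForm I M) : Prop :=
  IsLRegular D L C ∧
  ∃ (φ : ∀ z : M, TangentSpace I z → TangentSpace I z) (v G N : VForm I M),
    (∀ z : M, Set.InvOn (φ z) (connMap D C z) (vert L z) (vert L z)) ∧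
    (∀ (z : M) (w : TangentSpace I z), v z w = φ z (connMap D C z w)) ∧
    (∀ (z : M) (w : TangentSpace I z),
      G z (L z w) = -(w - v z w) ∧ G z (w - v z w) = L z w) ∧
    (∀ (z : M) (w : TangentSpace I z),
      N z (L z w) = w - v z w ∧ N z (w - v z w) = L z w) ∧
    (∀ (z : M) (w : TangentSpace I z), Γ z w = N z (G z w))

/-- `D` is the Berwald `L`-lift of `Γ`: an `L`-normal linear connection inducing `Γ`
(an `L`-lift of `Γ`) which is reducible (`D Γ = 0`) and whose torsion satisfies `T(LX, Y) = 0`. -/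
structure IsBerwaldLift (L : VForm I M) (C : VField I M) (Γ : VForm I M) : Prop where
  normal : IsLNormal D L C
  induces : IsInducedBy D L C Γ
  reducible : IsParallel D Γ
  torsion_vert : ∀ X Y : VField I M,
    nabla D (op L X) Y - nabla D Y (op L X) - lie (op L X) Y = 0

/-- The curvature of the linear connection `D`:
`𝐑(X, Y) Z = D_X D_Y Z - D_Y D_X Z - D_{[X, Y]} Z`. -/
def curv (X Y Z : VField I M) : VField I M :=
  nabla D X (nabla D Y Z) - nabla D Y (nabla D X Z) - nabla D (lie X Y) Z

/-- `R(X, Y) Z = 𝐑(hX, hY) LZ`. -/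
def curvR (L Γ : VForm I M) (X Y Z : VField I M) : VField I M :=
  curv D (hor Γ X) (hor Γ Y) (op L Z)

/-- `P(X, Y) Z = 𝐑(hX, LY) LZ`. -/
def curvP (L Γ : VForm I M) (X Y Z : VField I M) : VField I M :=
  curv D (hor Γ X) (op L Y) (op L Z)

/-- The covariant derivative `((D_W A)(X, Y)) Z` of a tensor `A`, written `(X, Y, Z) ↦ A(X, Y) Z`. -/
def covTensor (A : VField I M → VField I M → VField I M → VField I M)
    (W X Y Z : VField I M) : VField I M :=
  nabla D W (A X Y Z) - A (nabla D W X) Y Z - A X (nabla D W Y) Z - A X Y (nabla D W Z)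

/-- The cyclic sum of `f` over `X, Y, Z`. -/
def cyclicSum (f : VField I M → VField I M → VField I M → VField I M)
    (X Y Z : VField I M) : VField I M :=
  f X Y Z + f Y Z X + f Z X Y

end Bracket

end

end LConn

/-! ### Connections on a Lie ring -/

namespace LieRing

variable {V : Type*} [LieRing V]

/-- The torsion of a biadditive operation on a Lie ring. -/
def torsion (D : V →+ V →+ V) (X Y : V) : V := D X Y - D Y X - ⁅X, Y⁆

/-- The curvature of a biadditive operation on a Lie ring. -/
def curvature (D : V →+ V →+ V) (X Y Z : V) : V := D X (D Y Z) - D Y (D X Z) - D ⁅X, Y⁆ Z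

/-- The covariant derivative of the torsion. -/
def covTorsion (D : V →+ V →+ V) (W X Y : V) : V :=
  D W (torsion D X Y) - torsion D (D W X) Y - torsion D X (D W Y)

/-- The covariant derivative of the curvature. -/
def covCurvature (D : V →+ V →+ V) (W X Y Z : V) : V :=
  D W (curvature D X Y Z) - curvature D (D W X) Y Z - curvature D X (D W Y) Z
    - curvature D X Y (D W Z)

variable (D : V →+ V →+ V)

theorem torsion_swap (X Y : V) : torsion D X Y = -torsion D Y X := by
  have h := lie_skew X Y
  simp only [torsion, ← h]
  abel

theorem curvature_swap (X Y Z : V) : curvature D X Y Z = -curvature D Y X Z := by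
  have h := lie_skew X Y
  simp only [curvature, ← h, map_neg, AddMonoidHom.neg_apply]
  abel

theorem curvature_zero_left (X Y : V) : curvature D 0 X Y = 0 := by
  simp only [curvature, map_zero, AddMonoidHom.zero_apply, zero_lie, sub_zero]

theorem curvature_zero_right (X Y : V) : curvature D X Y 0 = 0 := by
  simp only [curvature, map_zero, sub_zero]

theorem covCurvature_swap (W X Y Z : V) : covCurvature D W X Y Z = -covCurvature D W Y X Z := by
  simp only [covCurvature, curvature_swap D X Y, curvature_swap D (D W X) Y,
    curvature_swap D X (D W Y), map_neg]
  abel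

theorem lie_lie_cyclic (X Y Z : V) : ⁅⁅X, Y⁆, Z⁆ + ⁅⁅Y, Z⁆, X⁆ + ⁅⁅Z, X⁆, Y⁆ = 0 := by
  have h := lie_jacobi X Y Z
  rw [← lie_skew ⁅X, Y⁆ Z, ← lie_skew ⁅Y, Z⁆ X, ← lie_skew ⁅Z, X⁆ Y]
  rw [← neg_eq_zero, ← h]
  abel

/-- The first Bianchi identity. -/
theorem first_bianchi (X Y Z : V) :
    curvature D X Y Z + curvature D Y Z X + curvature D Z X Y =
      torsion D (torsion D X Y) Z + torsion D (torsion D Y Z) X + torsion D (torsion D Z X) Y +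
        (covTorsion D X Y Z + covTorsion D Y Z X + covTorsion D Z X Y) := by
  have h := lie_lie_cyclic X Y Z
  rw [← sub_eq_zero, ← neg_eq_zero, ← h]
  simp only [curvature, covTorsion, torsion, map_sub, AddMonoidHom.sub_apply, sub_lie,
    ← lie_skew (D X Z) Y, ← lie_skew (D Y X) Z, ← lie_skew (D Z Y) X]
  abel

/-- The second Bianchi identity. -/
theorem second_bianchi (X Y Z W : V) :
    covCurvature D X Y Z W + covCurvature D Y Z X W + covCurvature D Z X Y W +
      (curvature D (torsion D X Y) Z W + curvature D (torsion D Y Z) X W +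
        curvature D (torsion D Z X) Y W) = 0 := by
  have h := congrArg (fun U => D U W) (lie_lie_cyclic X Y Z)
  simp only [map_add, map_zero, AddMonoidHom.add_apply, AddMonoidHom.zero_apply] at h
  rw [← h]
  simp only [curvature, covCurvature, torsion, map_sub, AddMonoidHom.sub_apply, sub_lie,
    ← lie_skew (D X Z) Y, ← lie_skew (D Y X) Z, ← lie_skew (D Z Y) X, map_neg,
    AddMonoidHom.neg_apply]
  abel

theorem cyclic_covCurvature (X Y Z W : V) :
    covCurvature D X Y Z W + covCurvature D Y Z X W + covCurvature D Z X Y W =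
      curvature D X (torsion D Y Z) W + curvature D Y (torsion D Z X) W +
        curvature D Z (torsion D X Y) W := by
  have H := second_bianchi D X Y Z W
  simp only [curvature_swap D (torsion D _ _)] at H
  rw [← sub_eq_zero, ← H]
  abel

/-- The algebraic properties of a connection `D` which preserves an almost tangent structure `L` and
a compatible horizontal projector `h`, and whose torsion is semibasic with vertical values. -/
structure IsSemibasicTorsionConnection (D : V →+ V →+ V)
    (L h F : V →+ V) : Prop where
  h_L : ∀ X, h (L X) = 0
  L_h : ∀ X, L (h X) = L X
  h_h : ∀ X, h (h X) = h X
  L_F : ∀ X, L (F X) = X - h X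
  D_L : ∀ X Y, D X (L Y) = L (D X Y)
  D_h : ∀ X Y, D X (h Y) = h (D X Y)
  torsion_L : ∀ X Y, torsion D (L X) Y = 0
  h_torsion : ∀ X Y, h (torsion D X Y) = 0

namespace IsSemibasicTorsionConnection

variable {D} {L h F : V →+ V}
  (hD : IsSemibasicTorsionConnection D L h F)
include hD

theorem L_eq_zero {X : V} (hX : h X = 0) : L X = 0 := by
  rw [← hD.L_h, hX, map_zero]

theorem L_F_of_h_eq_zero {X : V} (hX : h X = 0) : L (F X) = X := by
  rw [hD.L_F, hX, sub_zero]

theorem torsion_of_h_eq_zero {X : V} (hX : h X = 0) (Y : V) : torsion D X Y = 0 := by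
  rw [← hD.L_F_of_h_eq_zero hX, hD.torsion_L]

theorem torsion_L_right (X Y : V) : torsion D X (L Y) = 0 := by
  rw [torsion_swap, hD.torsion_L, neg_zero]

theorem torsion_h_h (X Y : V) : torsion D (h X) (h Y) = h ⁅h X, h Y⁆ - ⁅h X, h Y⁆ := by
  have H := hD.h_torsion (h X) (h Y)
  simp only [torsion, map_sub, ← hD.D_h, hD.h_h] at H
  rw [sub_eq_zero] at H
  rw [torsion, H]

theorem torsion_torsion (X Y Z : V) : torsion D (torsion D X Y) Z = 0 :=
  hD.torsion_of_h_eq_zero (hD.h_torsion X Y) Z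

theorem h_covTorsion (X Y Z : V) : h (covTorsion D X Y Z) = 0 := by
  simp only [covTorsion, map_sub, ← hD.D_h, hD.h_torsion, map_zero, sub_zero]

theorem covTorsion_L_left (X Y Z : V) : covTorsion D X (L Y) Z = 0 := by
  simp only [covTorsion, hD.D_L, hD.torsion_L, map_zero, sub_zero]

theorem covTorsion_L_right (X Y Z : V) : covTorsion D X Y (L Z) = 0 := by
  simp only [covTorsion, hD.D_L, hD.torsion_L_right, map_zero, sub_zero]

theorem curvature_L (X Y Z : V) : curvature D X Y (L Z) = L (curvature D X Y Z) := by
  simp only [curvature, hD.D_L, map_sub]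

theorem curvature_h (X Y Z : V) : curvature D X Y (h Z) = h (curvature D X Y Z) := by
  simp only [curvature, hD.D_h, map_sub]

theorem curvature_L_eq (X Y Z : V) : curvature D X Y (L Z) = L (curvature D X Y (h Z)) := by
  rw [hD.curvature_h, hD.L_h, hD.curvature_L]

theorem h_cyclic_curvature (X Y Z : V) :
    h (curvature D X Y Z + curvature D Y Z X + curvature D Z X Y) = 0 := by
  rw [first_bianchi]
  simp only [hD.torsion_torsion, map_add, map_zero, hD.h_covTorsion, add_zero]

/-- The horizontal curvature satisfies the algebraic Bianchi identity. -/
theorem cyclic_curvature_h_h_L (X Y Z : V) :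
    curvature D (h X) (h Y) (L Z) + curvature D (h Y) (h Z) (L X) +
      curvature D (h Z) (h X) (L Y) = 0 := by
  simp only [hD.curvature_L_eq, ← map_add]
  exact hD.L_eq_zero (hD.h_cyclic_curvature _ _ _)

theorem curvature_L_L_h (X Y Z : V) : curvature D (L X) (L Y) (h Z) = 0 := by
  have H := hD.h_cyclic_curvature (h Z) (L X) (L Y)
  rw [map_add, map_add, ← hD.curvature_h _ _ (L Y), ← hD.curvature_h _ _ (L X),
    ← hD.curvature_h _ _ (h Z), hD.h_L, hD.h_L, hD.h_h, curvature_zero_right,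
    curvature_zero_right, zero_add, add_zero] at H
  exact H

theorem curvature_L_L_L (X Y Z : V) : curvature D (L X) (L Y) (L Z) = 0 := by
  rw [hD.curvature_L_eq, hD.curvature_L_L_h, map_zero]

theorem mixed_curvature_swap_right (X Y Z : V) :
    curvature D (h X) (L Y) (L Z) = curvature D (h X) (L Z) (L Y) := by
  have H := first_bianchi D (h X) (L Y) (L Z)
  simp only [hD.torsion_torsion, hD.covTorsion_L_left, hD.covTorsion_L_right,
    hD.curvature_L_L_h, add_zero] at H
  rw [curvature_swap D (h X) (L Z), eq_neg_iff_add_eq_zero]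
  exact H

theorem mixed_curvature_swap_outer (X Y Z : V) :
    curvature D (h X) (L Y) (L Z) = curvature D (h Z) (L Y) (L X) := by
  have H := hD.h_cyclic_curvature (h X) (L Y) (h Z)
  rw [map_add, map_add, ← hD.curvature_h _ _ (L Y), hD.h_L, ← hD.curvature_h _ _ (h X),
    ← hD.curvature_h _ _ (h Z), hD.h_h, hD.h_h] at H
  rw [curvature_zero_right, add_zero, curvature_swap D (L Y), add_neg_eq_zero] at H
  rw [hD.curvature_L_eq, H, ← hD.curvature_L_eq]

theorem mixed_curvature_swap_left (X Y Z : V) :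
    curvature D (h X) (L Y) (L Z) = curvature D (h Y) (L X) (L Z) := by
  rw [hD.mixed_curvature_swap_right, hD.mixed_curvature_swap_outer,
    hD.mixed_curvature_swap_right]

theorem covCurvature_L_L_L (W X Y Z : V) : covCurvature D W (L X) (L Y) (L Z) = 0 := by
  simp only [covCurvature, hD.D_L, hD.curvature_L_L_L, map_zero, sub_zero]

theorem curvature_torsion_L_L (X Y Z W : V) :
    curvature D (torsion D X Y) (L Z) (L W) = 0 := by
  rw [← hD.L_F_of_h_eq_zero (hD.h_torsion X Y), hD.curvature_L_L_L]

theorem covCurvature_mixed_vertical (X Y Z W : V) :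
    covCurvature D (L Z) (h X) (L Y) (L W) = covCurvature D (L Y) (h X) (L Z) (L W) := by
  have H := second_bianchi D (h X) (L Y) (L Z) (L W)
  simp only [hD.covCurvature_L_L_L, hD.torsion_L, hD.torsion_L_right, curvature_zero_left,
    add_zero, zero_add] at H
  rw [covCurvature_swap D (L Y) (h X), ← add_eq_zero_iff_eq_neg, add_comm]
  exact H

theorem covCurvature_vertical (X Y Z W : V) :
    covCurvature D (L Z) (h X) (h Y) (L W) =
      covCurvature D (h Y) (h X) (L Z) (L W) - covCurvature D (h X) (h Y) (L Z) (L W) := by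
  have H := second_bianchi D (h X) (h Y) (L Z) (L W)
  simp only [hD.torsion_L, hD.torsion_L_right, curvature_zero_left,
    hD.curvature_torsion_L_L, add_zero] at H
  rw [covCurvature_swap D (h Y) (h X), ← sub_eq_zero, ← H]
  abel

end IsSemibasicTorsionConnection

/-- If `[L, L] = 0`, `L² = 0` and `Γ = [L, S]`, then `[L, Γ] = 0`. -/
theorem lie_form_field_commute {L Γ : V →+ V} {S : V}
    (hN : ∀ X Y, ⁅L X, L Y⁆ = L (⁅L X, Y⁆ + ⁅X, L Y⁆))
    (hΓ : ∀ X, Γ X = ⁅L X, S⁆ - L ⁅X, S⁆) (X Y : V) :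
    ⁅Γ X, L Y⁆ + ⁅L X, Γ Y⁆ =
      Γ (⁅L X, Y⁆ + ⁅X, L Y⁆) + L (⁅Γ X, Y⁆ + ⁅X, Γ Y⁆) := by
  have hs : ∀ A B : V, ⁅⁅A, B⁆, S⁆ = ⁅⁅A, S⁆, B⁆ + ⁅A, ⁅B, S⁆⁆ := fun A B => by
    have h := leibniz_lie A B S
    rw [h, ← lie_skew ⁅A, S⁆ B]
    abel
  have h0 := congrArg (fun U => ⁅U, S⁆) (hN X Y)
  have h1 := hN ⁅X, S⁆ Y
  have h2 := hN X ⁅Y, S⁆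
  have h3 : ∀ U, ⁅L U, S⁆ = Γ U + L ⁅U, S⁆ := fun U => by rw [hΓ]; abel
  simp only [h3, hs, add_lie, lie_add, h1, h2, map_add] at h0 ⊢
  rw [← sub_eq_zero] at h0 ⊢
  rw [← h0]
  abel

end LieRing

namespace LConn

open LieRing

section Extension

variable {E : Type*} [NormedAddCommGroup E] [NormedSpace ℝ E] [FiniteDimensional ℝ E]
  {H : Type*} [TopologicalSpace H] {I : ModelWithCorners ℝ E H}
  {M : Type*} [TopologicalSpace M] [ChartedSpace H M] [IsManifold I ∞ M]

/-- Every tangent vector is the value of a smooth vector field. -/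
theorem exists_vField_apply_eq [T2Space M] (z : M) (w : TangentSpace I z) :
    ∃ X : VField I M, X z = w := by
  let e := trivializationAt E (TangentSpace I : M → Type _) z
  have hsec : ContMDiffOn I (I.prod 𝓘(ℝ, E)) ∞
      (fun x => (⟨x, FiberBundle.extend E w x⟩ : Bundle.TotalSpace E (TangentSpace I : M → Type _)))
      e.baseSet := by
    rw [e.contMDiffOn_section_baseSet_iff]
    refine (contMDiffOn_const (c := (e ⟨z, w⟩).2)).congr fun y hy => ?_
    change (e ⟨y, e.symm y (e ⟨z, w⟩).2⟩).2 = _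
    rw [e.apply_mk_symm hy]
  obtain ⟨f, hf, -⟩ := (SmoothBumpFunction.nhds_basis_support (I := I) (c := z)
    (e.open_baseSet.mem_nhds (FiberBundle.mem_baseSet_trivializationAt' z))).mem_iff.1
      Filter.univ_mem
  refine ⟨⟨_, ContMDiffOn.smul_section_of_tsupport (f.contMDiff.contMDiffOn) e.open_baseSet hf
    hsec⟩, ?_⟩
  change f z • FiberBundle.extend E w z = w
  simp

end Extension

section Structure

variable {E : Type*} [NormedAddCommGroup E] [NormedSpace ℝ E] [FiniteDimensional ℝ E]
  {H : Type*} [TopologicalSpace H] {I : ModelWithCorners ℝ E H}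
  {M : Type*} [TopologicalSpace M] [ChartedSpace H M] [IsManifold I ∞ M]

omit [FiniteDimensional ℝ E] in
theorem VField.mdifferentiableAt (X : VField I M) (z : M) :
    MDifferentiableAt I (I.prod 𝓘(ℝ, E))
      (fun x => (⟨x, X x⟩ : Bundle.TotalSpace E (TangentSpace I : M → Type _))) z :=
  (X.contMDiff z).mdifferentiableAt (by simp)

/-- Smooth vector fields form a Lie ring. -/
noncomputable instance : LieRing (VField I M) where
  bracket := lie
  add_lie X Y Z := by
    ext z
    exact VectorField.mlieBracket_add_left (X.mdifferentiableAt z) (Y.mdifferentiableAt z)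
  lie_add X Y Z := by
    ext z
    exact VectorField.mlieBracket_add_right (Y.mdifferentiableAt z) (Z.mdifferentiableAt z)
  lie_self X := by
    ext z
    exact congrFun (VectorField.mlieBracket_self (V := ⇑X)) z
  leibniz_lie X Y Z := by
    ext z
    have : CompleteSpace E := FiniteDimensional.complete ℝ E
    have : IsManifold I (minSmoothness ℝ 3) M := by
      rw [minSmoothness_of_isRCLikeNormedField]
      exact IsManifold.of_le (n := ∞) (WithTop.coe_le_coe.2 (le_top : (3 : ℕ∞) ≤ ⊤))
    have hs (X : VField I M) := (X.contMDiff z).of_le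
      (show minSmoothness ℝ 2 ≤ ∞ by
        rw [minSmoothness_of_isRCLikeNormedField]
        exact WithTop.coe_le_coe.2 (le_top : (2 : ℕ∞) ≤ ⊤))
    exact VectorField.leibniz_identity_mlieBracket_apply (hs X) (hs Y) (hs Z)

theorem lie_def (X Y : VField I M) : lie X Y = ⁅X, Y⁆ := rfl

/-- The covariant derivative as a biadditive operation on smooth vector fields. -/
noncomputable def nablaHom (D : CovariantDerivative I E (TangentSpace I : M → Type _))
    [CovariantDerivative.ContMDiffCovariantDerivative D ∞] :
    VField I M →+ VField I M →+ VField I M :=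
  AddMonoidHom.mk' (fun X => AddMonoidHom.mk' (nabla D X) fun Y Z => by
      ext z
      exact congrArg (fun A => A (X z)) (D.isCovariantDerivativeOn.add
        (Y.mdifferentiableAt z) (Z.mdifferentiableAt z)))
    fun X Y => by
      ext Z z
      exact map_add (D Z z) (X z) (Y z)

end Structure

section Berwald

variable {E : Type*} [NormedAddCommGroup E] [NormedSpace ℝ E] [FiniteDimensional ℝ E]
  {H : Type*} [TopologicalSpace H] {I : ModelWithCorners ℝ E H}
  {M : Type*} [TopologicalSpace M] [ChartedSpace H M] [IsManifold I ∞ M]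
  {n : ℕ} {L Γ F : VForm I M} {C : VField I M}

omit [FiniteDimensional ℝ E] in
theorem hor_apply (Γ : VForm I M) (X : VField I M) :
    hor Γ X = (1 / 2 : ℝ) • (X + op Γ X) := rfl

theorem IsLStructure.op_op (hL : IsLStructure n L C) (X : VField I M) :
    op L (op L X) = 0 := by
  ext z
  have h : L z (X z) ∈ (L z).ker := hL.range_eq_ker z ▸ LinearMap.mem_range_self _ _
  exact h

theorem IsLStructure.lie_op_op (hL : IsLStructure n L C) (X Y : VField I M) :
    ⁅op L X, op L Y⁆ = op L (⁅op L X, Y⁆ + ⁅X, op L Y⁆) := by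
  have h := hL.nijenhuis X Y
  simp only [fnFormForm, hL.op_op, lie_def, add_zero] at h
  rw [map_add]
  have h2 : (2 : ℝ) • (⁅op L X, op L Y⁆ - (op L ⁅op L X, Y⁆ + op L ⁅X, op L Y⁆)) = 0 := by
    rw [← h]
    module
  exact sub_eq_zero.1 ((smul_eq_zero.1 h2).resolve_left two_ne_zero)

omit [FiniteDimensional ℝ E] in
theorem IsLConnection.op_L_op (hΓ : IsLConnection L Γ) (X : VField I M) :
    op L (op Γ X) = op L X := by
  ext z
  exact hΓ.left z (X z)

omit [FiniteDimensional ℝ E] in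
theorem IsLConnection.op_op_L (hΓ : IsLConnection L Γ) (X : VField I M) :
    op Γ (op L X) = -op L X := by
  ext z
  exact hΓ.right z (X z)

omit [FiniteDimensional ℝ E] in
theorem IsLConnection.L_hor (hΓ : IsLConnection L Γ) (X : VField I M) :
    op L (hor Γ X) = op L X := by
  rw [hor_apply, map_smul, map_add, hΓ.op_L_op]
  module

omit [FiniteDimensional ℝ E] in
theorem IsLConnection.hor_L (hΓ : IsLConnection L Γ) (X : VField I M) :
    hor Γ (op L X) = 0 := by
  rw [hor_apply, hΓ.op_op_L, add_neg_cancel, smul_zero]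

/-- `L F` is the vertical projector of `Γ`. -/
theorem IsAssociatedComplex.L_F [T2Space M] (hL : IsLStructure n L C) (hΓ : IsLConnection L Γ)
    (hF : IsAssociatedComplex L Γ F) (X : VField I M) :
    op L (op F X) = X - hor Γ X := by
  have hvert : op L (op F (X - hor Γ X)) = X - hor Γ X := by
    ext z
    have hker : (X - hor Γ X) z ∈ (L z).ker := by
      have h : op L (X - hor Γ X) = 0 := by rw [map_sub, hΓ.L_hor, sub_self]
      exact congrArg (fun Y : VField I M => Y z) h
    rw [← hL.range_eq_ker z] at hker
    obtain ⟨w, hw⟩ := hker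
    obtain ⟨Y, rfl⟩ := exists_vField_apply_eq z w
    have h := congrArg (fun Z : VField I M => Z z) (congrArg (op L) (hF.comp_L Y))
    rw [hΓ.L_hor] at h
    change L z (F z ((X - hor Γ X) z)) = _
    rw [← hw]
    exact h
  rw [map_sub, map_sub, hF.comp_h, map_neg, hL.op_op, neg_zero, sub_zero] at hvert
  exact hvert

variable {D : CovariantDerivative I E (TangentSpace I : M → Type _)}
  [CovariantDerivative.ContMDiffCovariantDerivative D ∞]

omit [FiniteDimensional ℝ E] in
theorem nablaHom_apply (X Y : VField I M) : nablaHom D X Y = nabla D X Y := rfl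

omit [FiniteDimensional ℝ E] in
theorem IsParallel.nablaHom_hor (hD : IsParallel D Γ) (X Y : VField I M) :
    nablaHom D X (hor Γ Y) = hor Γ (nablaHom D X Y) := by
  have h2 : ∀ Z : VField I M, hor Γ Z + hor Γ Z = Z + op Γ Z := fun Z => by
    rw [hor_apply]; module
  have h : nablaHom D X (hor Γ Y + hor Γ Y) =
      hor Γ (nablaHom D X Y) + hor Γ (nablaHom D X Y) := by
    rw [h2, h2, map_add]
    exact congrArg _ (hD X Y)
  rw [map_add, ← two_smul ℝ, ← two_smul ℝ (hor Γ _)] at h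
  exact smul_right_injective _ two_ne_zero h

/-- A conservative `L`-connection has vanishing torsion, stated on horizontal vector fields. -/
theorem IsConservative.vert_lie_hor (hL : IsLStructure n L C) (hΓ : IsConservative L C Γ)
    {X Y : VField I M} (hX : hor Γ X = X) (hY : hor Γ Y = Y) :
    ⁅op L X, Y⁆ + ⁅X, op L Y⁆ - hor Γ (⁅op L X, Y⁆ + ⁅X, op L Y⁆) = op L ⁅X, Y⁆ := by
  obtain ⟨S, -, hS⟩ := hΓ.exists_spray
  have h := lie_form_field_commute (L := (op L).toAddMonoidHom) (Γ := (op Γ).toAddMonoidHom)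
    (S := S) hL.lie_op_op (fun X => by
      change op Γ X = ⁅op L X, S⁆ - op L ⁅X, S⁆
      rw [hS, fnFormField, fnFieldForm, lie_def, lie_def, ← lie_skew S, ← lie_skew S, map_neg]
      abel) X Y
  have hfix : ∀ Z : VField I M, hor Γ Z = Z → op Γ Z = Z := fun Z hZ => by
    have h : op Γ Z = (2 : ℝ) • hor Γ Z - Z := by rw [hor_apply]; module
    rw [h, hZ]
    module
  simp only [LinearMap.toAddMonoidHom_coe, hfix X hX, hfix Y hY] at h
  rw [hor_apply, ← sub_eq_zero]
  have hA : ⁅op L X, Y⁆ + ⁅X, op L Y⁆ = op Γ (⁅op L X, Y⁆ + ⁅X, op L Y⁆) +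
      op L (⁅X, Y⁆ + ⁅X, Y⁆) := (add_comm _ _).trans h
  rw [map_add (op L), ← sub_eq_zero] at hA
  refine Eq.trans ?_ (smul_eq_zero_of_right (1 / 2 : ℝ) hA)
  module

theorem isSemibasicTorsionConnection_of_isBerwaldLift [T2Space M] (hL : IsLStructure n L C)
    (hΓ : IsConservative L C Γ) (hF : IsAssociatedComplex L Γ F) (hD : IsBerwaldLift D L C Γ) :
    IsSemibasicTorsionConnection (nablaHom D) (op L).toAddMonoidHom (hor Γ).toAddMonoidHom
      (op F).toAddMonoidHom := by
  have hLF := hF.L_F hL hΓ.connection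
  have hh (X : VField I M) : hor Γ (hor Γ X) = hor Γ X := by
    have h := hΓ.connection.hor_L (op F X)
    rw [hLF, map_sub, sub_eq_zero] at h
    exact h.symm
  have hDL (X Y : VField I M) : nablaHom D X (op L Y) = op L (nablaHom D X Y) :=
    hD.normal.almostTangent X Y
  have hDh := hD.reducible.nablaHom_hor
  have hT (X Y : VField I M) : torsion (nablaHom D) (op L X) Y = 0 := hD.torsion_vert X Y
  have hT' (X Y : VField I M) : torsion (nablaHom D) X (op L Y) = 0 := by
    rw [torsion_swap, hT, neg_zero]
  have hTh (X Y : VField I M) :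
      torsion (nablaHom D) X Y = torsion (nablaHom D) (hor Γ X) (hor Γ Y) := by
    have h1 := hT (op F X) Y
    have h2 := hT' (hor Γ X) (op F Y)
    rw [hLF] at h1 h2
    rw [← sub_eq_zero, ← add_zero (0 : VField I M)]
    nth_rw 1 [← h1]
    rw [← h2]
    simp only [torsion, map_sub, AddMonoidHom.sub_apply, sub_lie, lie_sub]
    abel
  have hLT (X Y : VField I M) (hX : hor Γ X = X) (hY : hor Γ Y = Y) :
      op L (torsion (nablaHom D) X Y) = 0 := by
    have h := hΓ.vert_lie_hor hL hX hY
    have h1 : ⁅op L X, Y⁆ = nablaHom D (op L X) Y - op L (nablaHom D Y X) := by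
      rw [← hDL]
      exact (sub_eq_zero.1 (hT X Y)).symm
    have h2 : ⁅X, op L Y⁆ = op L (nablaHom D X Y) - nablaHom D (op L Y) X := by
      rw [← hDL]
      exact (sub_eq_zero.1 (hT' X Y)).symm
    rw [h1, h2, map_add, map_sub, map_sub, ← hDh, ← hDh, hX, hY, hΓ.connection.hor_L,
      hΓ.connection.hor_L] at h
    rw [torsion, map_sub, map_sub, ← h]
    abel
  exact
    { h_L := hΓ.connection.hor_L
      L_h := hΓ.connection.L_hor
      h_h := hh
      L_F := hLF
      D_L := hDL
      D_h := hDh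
      torsion_L := hT
      h_torsion := fun X Y => by
        have h := hF.comp_L (torsion (nablaHom D) X Y)
        rw [hTh X Y, hLT _ _ (hh X) (hh Y), map_zero] at h
        rw [hTh X Y]
        exact h.symm }

/-- The curvature of `Γ` is the torsion, on horizontal parts, of its Berwald lift. -/
theorem Omega_eq_torsion [T2Space M] (hL : IsLStructure n L C)
    (hΓ : IsConservative L C Γ) (hF : IsAssociatedComplex L Γ F) (hD : IsBerwaldLift D L C Γ)
    (X Y : VField I M) :
    Omega Γ X Y = torsion (nablaHom D) (hor Γ X) (hor Γ Y) := by
  have hB := isSemibasicTorsionConnection_of_isBerwaldLift hL hΓ hF hD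
  have hvv : hor Γ ⁅X - hor Γ X, Y - hor Γ Y⁆ = 0 := by
    have hLF := hF.L_F hL hΓ.connection
    rw [← hLF, ← hLF, hL.lie_op_op, hΓ.connection.hor_L]
  have hhh (Z : VField I M) : hor Γ (hor Γ Z) = hor Γ Z := hB.h_h Z
  have hT : torsion (nablaHom D) (hor Γ X) (hor Γ Y) =
    hor Γ ⁅hor Γ X, hor Γ Y⁆ - ⁅hor Γ X, hor Γ Y⁆ := hB.torsion_h_h X Y
  rw [hT, Omega, fnFormForm, ← sub_eq_zero, ← neg_eq_zero, ← hvv]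
  simp only [lie_def, hhh, sub_lie, lie_sub, map_sub]
  module

theorem curvR_eq (X Y Z : VField I M) : curvR D L Γ X Y Z =
    curvature (nablaHom D) (hor Γ X) (hor Γ Y) (op L Z) := rfl

theorem curvP_eq (X Y Z : VField I M) : curvP D L Γ X Y Z =
    curvature (nablaHom D) (hor Γ X) (op L Y) (op L Z) := rfl

theorem IsBerwaldLift.covTensor_curvR (hD : IsBerwaldLift D L C Γ) (W X Y Z : VField I M) :
    covTensor D (curvR D L Γ) W X Y Z =
      covCurvature (nablaHom D) W (hor Γ X) (hor Γ Y) (op L Z) := by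
  have hDL : nablaHom D W (op L Z) = op L (nablaHom D W Z) := hD.normal.almostTangent W Z
  simp only [covTensor, covCurvature, curvR_eq, hD.reducible.nablaHom_hor, hDL, nablaHom_apply]

theorem IsBerwaldLift.covTensor_curvP (hD : IsBerwaldLift D L C Γ) (W X Y Z : VField I M) :
    covTensor D (curvP D L Γ) W X Y Z =
      covCurvature (nablaHom D) W (hor Γ X) (op L Y) (op L Z) := by
  have hDL (Z) : nablaHom D W (op L Z) = op L (nablaHom D W Z) := hD.normal.almostTangent W Z
  simp only [covTensor, covCurvature, curvP_eq, hD.reducible.nablaHom_hor, hDL, nablaHom_apply]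

end Berwald

end LConn

theorem proposition11 {E : Type*} [NormedAddCommGroup E] [NormedSpace ℝ E]
    [FiniteDimensional ℝ E] {H : Type*} [TopologicalSpace H] (I : ModelWithCorners ℝ E H)
    [I.Boundaryless] {M : Type*} [TopologicalSpace M] [T2Space M] [ChartedSpace H M]
    [IsManifold I ∞ M] (n : ℕ) (L : LConn.VForm I M) (C : LConn.VField I M)
    (hL : LConn.IsLStructure n L C)
    (Γ F : LConn.VForm I M) (hΓ : LConn.IsConservative L C Γ)
    (hF : LConn.IsAssociatedComplex L Γ F)
    (D : CovariantDerivative I E (TangentSpace I : M → Type _))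
    [CovariantDerivative.ContMDiffCovariantDerivative D ∞] (hD : LConn.IsBerwaldLift D L C Γ) :
    (∀ X Y Z : LConn.VField I M, LConn.cyclicSum (LConn.curvR D L Γ) X Y Z = 0) ∧
    (∀ X Y Z W : LConn.VField I M,
      LConn.cyclicSum
          (fun X Y Z => LConn.covTensor D (LConn.curvR D L Γ) (LConn.hor Γ X) Y Z W) X Y Z =
        LConn.cyclicSum
          (fun X Y Z => LConn.curvP D L Γ X (LConn.op F (LConn.Omega Γ Y Z)) W) X Y Z) ∧
    (∀ X Y Z W : LConn.VField I M,
      LConn.covTensor D (LConn.curvR D L Γ) (LConn.op L Z) X Y W =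
        LConn.covTensor D (LConn.curvP D L Γ) (LConn.hor Γ Y) X Z W -
          LConn.covTensor D (LConn.curvP D L Γ) (LConn.hor Γ X) Y Z W) ∧
    (∀ X Y Z W : LConn.VField I M,
      LConn.covTensor D (LConn.curvP D L Γ) (LConn.op L Z) X Y W =
        LConn.covTensor D (LConn.curvP D L Γ) (LConn.op L Y) X Z W) ∧
    (∀ X Y Z : LConn.VField I M,
      LConn.curvP D L Γ X Y Z = LConn.curvP D L Γ Y X Z ∧
      LConn.curvP D L Γ X Y Z = LConn.curvP D L Γ Z X Y) := by
  have hB := LConn.isSemibasicTorsionConnection_of_isBerwaldLift hL hΓ hF hD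
  refine ⟨hB.cyclic_curvature_h_h_L, fun X Y Z W => ?_, fun X Y Z W => ?_, fun X Y Z W => ?_,
    fun X Y Z => ⟨hB.mixed_curvature_swap_left X Y Z, ?_⟩⟩
  · have hP (A B G : LConn.VField I M) :
        LConn.curvP D L Γ A (LConn.op F (LConn.Omega Γ B G)) W =
          LieRing.curvature (LConn.nablaHom D) (LConn.hor Γ A)
            (LieRing.torsion (LConn.nablaHom D) (LConn.hor Γ B) (LConn.hor Γ G)) (LConn.op L W) := by
      rw [LConn.curvP_eq, LConn.Omega_eq_torsion hL hΓ hF hD]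
      exact congrArg (fun U => LieRing.curvature (LConn.nablaHom D) (LConn.hor Γ A) U (LConn.op L W))
        (hB.L_F_of_h_eq_zero (hB.h_torsion _ _))
    simp only [LConn.cyclicSum, hD.covTensor_curvR, hP]
    exact LieRing.cyclic_covCurvature _ _ _ _ _
  · simp only [hD.covTensor_curvR, hD.covTensor_curvP]
    exact hB.covCurvature_vertical X Y Z W
  · simp only [hD.covTensor_curvP]
    exact hB.covCurvature_mixed_vertical X Y Z W
  · exact (hB.mixed_curvature_swap_outer X Y Z).trans (hB.mixed_curvature_swap_right Z Y X)
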